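/- Let $d\ge 1$ and let $\mathcal U_d$ be the group of unitary $d\times d$ matrices with its normalized Haar measure $\mu$. For a unitary $n\times n$ matrix $W$, let $\mathcal P_W$ be the von Neumann measurement in the orthonormal basis $W|1\rangle,\dots,W|n\rangle$, regarded as the quantum channel $\mathcal P_W(\sigma)=\sum_{i=1}^n \langle i|W^\dagger\sigma W|i\rangle\,|i\rangle\langle i|$. For two channels $\Phi,\Psi$ from $n\times n$ matrices to $n\times n$ matrices, let $$p^{e}_{\mathrm{opt}}(\Phi,\Psi)=\sup_{r,\sigma,M}\ \tfrac12\Big(\operatorname{tr}\big(M_0\,(\Phi\otimes \mathrm{id}_r)(\sigma)\big)+\operatorname{tr}\big(M_1\,(\Psi\otimes \mathrm{id}_r)(\sigma)\big)\Big)$$ be the optimal probability of discriminating $\Phi$ and $\Psi$ (with equal a priori probabilities) with the assistance of entanglement, where the supremum is over all finite ancilla dimensions $r$, all density matrices $\sigma$ on $\mathbb C^n\otimes\mathbb C^r$ and all two-outcome POVMs $(M_0,M_1)$ on $\mathbb C^n\otimes\mathbb C^r$. Thus $p^{e}_{\mathrm{opt}}(\mathcal P_{U^{\otimes 2}},\mathcal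 P_{V^{\otimes 2}})$ is the optimal probability of discriminating $\mathcal P_U$ and $\mathcal P_V$ using two (parallel) queries and the assistance of entanglement. Theorem. If $U$ and $V$ are independent random matrices, each distributed according to the Haar measure $\mu$ on $\mathcal U_d$, then $$\Pr\big(p^{e}_{\mathrm{opt}}(\mathcal P_{U^{\otimes 2}},\mathcal P_{V^{\otimes 2}})<1\big)\le \frac1{2^{d-1}}.$$ -/

import Mathlib

open MeasureTheory ProbabilityTheory
open scoped Matrix Kronecker ENNReal ComplexOrder

noncomputable section

/-- The Borel σ-algebra on the unitary group (with the topology inherited from matrices). -/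
instance unitaryGroupMeasurableSpace (n : Type*) [Fintype n] [DecidableEq n] :
    MeasurableSpace (Matrix.unitaryGroup n ℂ) :=
  borel _

instance unitaryGroupBorelSpace (n : Type*) [Fintype n] [DecidableEq n] :
    BorelSpace (Matrix.unitaryGroup n ℂ) :=
  ⟨rfl⟩

instance unitaryGroupCompactSpace (n : Type*) [Fintype n] [DecidableEq n] :
    CompactSpace (Matrix.unitaryGroup n ℂ) := by
  apply isCompact_iff_compactSpace.mp
  have hK : IsCompact (Set.univ.pi fun _ : n => Set.univ.pi fun _ : n =>
      Metric.closedBall (0 : ℂ) 1) :=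
    isCompact_univ_pi fun _ => isCompact_univ_pi fun _ => isCompact_closedBall _ _
  refine IsCompact.of_isClosed_subset (s := Set.univ.pi fun _ : n => Set.univ.pi fun _ : n =>
      Metric.closedBall (0 : ℂ) 1) hK ?_ ?_
  · have h : ((Matrix.unitaryGroup n ℂ : Submonoid (Matrix n n ℂ)) : Set (Matrix n n ℂ)) =
        {A | A * star A = 1} := by
      ext A
      exact Matrix.mem_unitaryGroup_iff
    rw [h]
    exact isClosed_eq (by fun_prop) continuous_const
  · intro A hA i _ j _
    simpa using entry_norm_bound_of_unitary hA i j

/-- The normalized Haar measure on the unitary group. -/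
def haarUnitary (n : Type*) [Fintype n] [DecidableEq n] : Measure (Matrix.unitaryGroup n ℂ) :=
  Measure.haarMeasure ⊤

instance haarUnitaryIsProbabilityMeasure (n : Type*) [Fintype n] [DecidableEq n] :
    IsProbabilityMeasure (haarUnitary n) :=
  ⟨by simpa [haarUnitary] using
    Measure.haarMeasure_self (K₀ := (⊤ : TopologicalSpace.PositiveCompacts
      (Matrix.unitaryGroup n ℂ)))⟩

section Quantum

variable {m n s : Type*} [Fintype m] [DecidableEq m] [Fintype n] [DecidableEq n]
  [Fintype s] [DecidableEq s]

/-- A density matrix: positive semidefinite of trace one. -/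
def IsDensity (ρ : Matrix m m ℂ) : Prop :=
  ρ.PosSemidef ∧ ρ.trace = 1

/-- A POVM: a finite tuple of positive semidefinite matrices that add up to the identity. -/
def IsPOVM {k : Type*} [Fintype k] (M : k → Matrix m m ℂ) : Prop :=
  (∀ i, (M i).PosSemidef) ∧ ∑ i, M i = 1

/-- The channel `σ ↦ ∑ i, tr (M i * σ) |i⟩⟨i|` of a measurement `M` with outcomes `k`. -/
def measurementChannel {k : Type*} [Fintype k] [DecidableEq k] (M : k → Matrix m m ℂ) :
    Matrix m m ℂ →ₗ[ℂ] Matrix k k ℂ :=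
  ∑ i, (Matrix.traceLinearMap m ℂ ℂ ∘ₗ LinearMap.mulLeft ℂ (M i)).smulRight
    (Matrix.single i i (1 : ℂ))

/-- The rank-one projectors `|ψ_i⟩⟨ψ_i|` on the columns `ψ_i = U |i⟩` of a unitary matrix. -/
def columnProjector (U : Matrix.unitaryGroup n ℂ) (i : n) : Matrix n n ℂ :=
  Matrix.vecMulVec (U.1.col i) (star (U.1.col i))

/-- The von Neumann measurement `P_U`, as a channel with classical output. -/
def vonNeumann (U : Matrix.unitaryGroup n ℂ) : Matrix n n ℂ →ₗ[ℂ] Matrix n n ℂ :=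
  measurementChannel (columnProjector U)

/-- `U ⊗ U`, so that `vonNeumann (tensorSquare U)` is two parallel uses of `vonNeumann U`. -/
def tensorSquare (U : Matrix.unitaryGroup n ℂ) : Matrix.unitaryGroup (n × n) ℂ :=
  ⟨U.1 ⊗ₖ U.1, Matrix.kronecker_mem_unitary U.2 U.2⟩

/-- `Φ ⊗ id` on a bipartite system with ancilla index set `s`: apply `Φ` to each block. -/
def extendByAncilla (s : Type*) (Φ : Matrix m m ℂ →ₗ[ℂ] Matrix n n ℂ)
    (X : Matrix (m × s) (m × s) ℂ) : Matrix (n × s) (n × s) ℂ :=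
  Matrix.of fun p q => Φ (Matrix.of fun k l => X (k, p.2) (l, q.2)) p.1 q.1

/-- The probability of guessing correctly which of two equiprobable channels `Φ`, `Ψ` was applied
to the first part of `σ`, when the output is measured by `M` (outcome `0` means `Φ`). -/
def successProb (Φ Ψ : Matrix m m ℂ →ₗ[ℂ] Matrix n n ℂ) (σ : Matrix (m × s) (m × s) ℂ)
    (M : Fin 2 → Matrix (n × s) (n × s) ℂ) : ℝ :=
  1 / 2 * ((M 0 * extendByAncilla s Φ σ).trace.re + (M 1 * extendByAncilla s Ψ σ).trace.re)

/-- The optimal entanglement-assisted probability of discriminating `Φ` from `Ψ`: the supremum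
over all finite ancilla dimensions, all joint input states and all two-outcome POVMs. -/
def optimalSuccessProb (Φ Ψ : Matrix m m ℂ →ₗ[ℂ] Matrix n n ℂ) : ℝ :=
  sSup {p | ∃ (r : ℕ) (σ : Matrix (m × Fin r) (m × Fin r) ℂ)
    (M : Fin 2 → Matrix (n × Fin r) (n × Fin r) ℂ),
      IsDensity σ ∧ IsPOVM M ∧ p = successProb Φ Ψ σ M}

end Quantum

end

/-! Write `W = V† U` and `w = W₀₀`. Two facts give the bound: `|w|² ≤ 1/2` already forces perfect
discrimination, and `|w|² > 1/2` has Haar probability exactly `2^{-(d-1)}`.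

Perfect discrimination with `ρ` as the reduced input only needs the diagonal of `(V⊗V)† ρ (U⊗U)` to
vanish (`one_le_optimalSuccessProb_of_diag_eq_zero`). Take `ρ ∝ C₊⊗C₊ + C₋⊗C₋`, where `C±` is
`columnPairGram` at `z = w̄(1 ± i)`. The diagonal of `V† C₋ U` is `-i` times that of `V† C₊ U`, so
after tensor squaring the two contributions differ by `(-i)² = -1` and cancel. Positivity of `C±`
needs `|z|² = 2|w|² ≤ 1`, which is where the threshold `1/2` arises
(`one_le_optimalSuccessProb_tensorSquare`).

For the probability, a Haar column is compared with a complex Gaussian vector by Fubini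
(`haarUnitary_apply_zero_zero`). The Gaussian weight of `|z₀|² > ∑_{i>0} |z_i|²` is explicit,
because the tail of `|z₀|²` is exponential. -/

/-! ### Perfect discrimination of von Neumann measurements -/

section Discrimination

variable {m n s : Type*} [Fintype m] [DecidableEq m] [Fintype n] [DecidableEq n]
  [Fintype s] [DecidableEq s]

open scoped MatrixOrder Matrix.Norms.L2Operator in
theorem Matrix.PosSemidef.exists_eq_conjTranspose_mul_self {A : Matrix m m ℂ}
    (hA : A.PosSemidef) : ∃ B : Matrix m m ℂ, A = Bᴴ * B :=
  CStarAlgebra.nonneg_iff_eq_star_mul_self.mp hA.nonneg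

theorem Matrix.PosSemidef.trace_mul_re_nonneg {A B : Matrix m m ℂ} (hA : A.PosSemidef)
    (hB : B.PosSemidef) : 0 ≤ (A * B).trace.re := by
  obtain ⟨C, rfl⟩ := hA.exists_eq_conjTranspose_mul_self
  rw [Matrix.mul_assoc, Matrix.trace_mul_comm]
  exact (Complex.nonneg_iff.mp (hB.mul_mul_conjTranspose_same C).trace_nonneg).1

/-- The Kraus operators of `vonNeumann U ⊗ id`. -/
def vonNeumannKraus (s : Type*) [DecidableEq s] (U : Matrix.unitaryGroup n ℂ) (i : n) :
    Matrix (n × s) (n × s) ℂ :=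
  (Matrix.single i i 1 * U.1ᴴ) ⊗ₖ (1 : Matrix s s ℂ)

theorem vonNeumann_apply (U : Matrix.unitaryGroup n ℂ) (X : Matrix n n ℂ) (i j : n) :
    vonNeumann U X i j = if i = j then (U.1ᴴ * X * U.1) i i else 0 := by
  have h (k : n) : (columnProjector U k * X).trace = (U.1ᴴ * X * U.1) k k := by
    rw [columnProjector, Matrix.vecMulVec_mul, Matrix.trace_vecMulVec, Matrix.mul_apply,
      dotProduct]
    refine Finset.sum_congr rfl fun l _ => ?_
    rw [mul_comm]
    rfl
  simp only [vonNeumann, measurementChannel, LinearMap.sum_apply, LinearMap.smulRight_apply,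
    LinearMap.comp_apply, LinearMap.mulLeft_apply, Matrix.traceLinearMap_apply, h,
    Matrix.sum_apply, Matrix.smul_apply, Matrix.single_apply, smul_eq_mul, mul_ite, mul_one,
    mul_zero]
  split_ifs with hij
  · subst hij
    simp
  · refine Finset.sum_eq_zero fun k _ => if_neg ?_
    rintro ⟨rfl, h⟩
    exact hij h

theorem extendByAncilla_vonNeumann (U : Matrix.unitaryGroup n ℂ)
    (X : Matrix (n × s) (n × s) ℂ) :
    extendByAncilla s (vonNeumann U) X =
      ∑ i, vonNeumannKraus s U i * X * (vonNeumannKraus s U i)ᴴ := by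
  ext ⟨i, a⟩ ⟨j, b⟩
  simp only [extendByAncilla, Matrix.of_apply, vonNeumann_apply, Matrix.sum_apply]
  have key (k : n) : (vonNeumannKraus s U k * X * (vonNeumannKraus s U k)ᴴ) (i, a) (j, b) =
      if k = i ∧ k = j then (U.1ᴴ * Matrix.of (fun p q => X (p, a) (q, b)) * U.1) k k
        else 0 := by
    have hK (l p : n) (c e : s) : vonNeumannKraus s U k (l, c) (p, e) =
        if c = e then if k = l then star (U.1 p k) else 0 else 0 := by
      by_cases h : k = l
      · subst h
        simp [vonNeumannKraus, Matrix.one_apply]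
      · simp [vonNeumannKraus, h, Matrix.single_mul_apply_of_ne _ _ _ _ _ (Ne.symm h)]
    simp only [Matrix.mul_apply, Matrix.conjTranspose_apply, Fintype.sum_prod_type, hK,
      Matrix.of_apply]
    by_cases h1 : k = i <;> by_cases h2 : k = j <;>
      simp [h1, h2, apply_ite (starRingEnd ℂ)]
  simp only [key]
  split_ifs with hij
  · subst hij
    simp
  · symm
    refine Finset.sum_eq_zero fun k _ => if_neg ?_
    rintro ⟨rfl, h⟩
    exact hij h

/-- Different classical outcomes are orthogonal, so only equal labels survive. This is why
discrimination reduces to a condition on diagonal entries alone. -/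
theorem conjTranspose_vonNeumannKraus_mul (U V : Matrix.unitaryGroup n ℂ) (i j : n) :
    (vonNeumannKraus s U i)ᴴ * vonNeumannKraus s V j =
      if i = j then (U.1 * Matrix.single i i 1 * V.1ᴴ) ⊗ₖ (1 : Matrix s s ℂ) else 0 := by
  rw [vonNeumannKraus, vonNeumannKraus, Matrix.conjTranspose_kronecker,
    ← Matrix.mul_kronecker_mul, Matrix.conjTranspose_mul, Matrix.conjTranspose_conjTranspose,
    Matrix.conjTranspose_single, Matrix.mul_assoc, ← Matrix.mul_assoc (Matrix.single i i _)]
  split_ifs with h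
  · subst h
    simp [Matrix.mul_assoc]
  · simp [Matrix.single_mul_single_of_ne, h]

theorem sum_conjTranspose_vonNeumannKraus_mul (U : Matrix.unitaryGroup n ℂ) :
    ∑ i, (vonNeumannKraus s U i)ᴴ * vonNeumannKraus s U i = 1 := by
  simp only [conjTranspose_vonNeumannKraus_mul, if_true]
  have h : ∑ i : n, Matrix.single i i (1 : ℂ) = 1 := Matrix.sum_single_one
  have h2 : ∑ i : n, U.1 * Matrix.single i i (1 : ℂ) * U.1ᴴ = 1 := by
    rw [← Finset.sum_mul, ← Finset.mul_sum, h, mul_one]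
    exact Matrix.mem_unitaryGroup_iff.mp U.2
  rw [← Matrix.one_kronecker_one, ← h2]
  ext ⟨i, a⟩ ⟨j, b⟩
  simp [Matrix.sum_apply, Finset.sum_mul]

theorem IsDensity.extendByAncilla_vonNeumann (U : Matrix.unitaryGroup n ℂ)
    {σ : Matrix (n × s) (n × s) ℂ} (hσ : IsDensity σ) :
    IsDensity (extendByAncilla s (vonNeumann U) σ) := by
  rw [_root_.extendByAncilla_vonNeumann]
  refine ⟨Matrix.posSemidef_sum _ fun i _ => hσ.1.mul_mul_conjTranspose_same _, ?_⟩
  simp only [Matrix.trace_sum, Matrix.trace_mul_comm _ (_)ᴴ, ← Matrix.mul_assoc]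
  rw [← Matrix.trace_sum, ← Finset.sum_mul, sum_conjTranspose_vonNeumannKraus_mul, one_mul, hσ.2]

theorem successProb_vonNeumann_le_one (U V : Matrix.unitaryGroup n ℂ)
    {σ : Matrix (n × s) (n × s) ℂ} {M : Fin 2 → Matrix (n × s) (n × s) ℂ}
    (hσ : IsDensity σ) (hM : IsPOVM M) :
    successProb (vonNeumann U) (vonNeumann V) σ M ≤ 1 := by
  have hsum : M 0 + M 1 = 1 := by simpa using hM.2
  have hX := hσ.extendByAncilla_vonNeumann U
  have hY := hσ.extendByAncilla_vonNeumann V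
  have h1 := (hM.1 1).trace_mul_re_nonneg hX.1
  have h0 := (hM.1 0).trace_mul_re_nonneg hY.1
  have e (Z : Matrix (n × s) (n × s) ℂ) (hZ : Z.trace = 1) :
      (M 0 * Z).trace.re + (M 1 * Z).trace.re = 1 := by
    rw [← Complex.add_re, ← Matrix.trace_add, ← add_mul, hsum, one_mul, hZ, Complex.one_re]
  have := e _ hX.2
  have := e _ hY.2
  unfold successProb
  linarith

theorem bddAbove_successProb_vonNeumann (U V : Matrix.unitaryGroup n ℂ) :
    BddAbove {p | ∃ (r : ℕ) (σ : Matrix (n × Fin r) (n × Fin r) ℂ)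
      (M : Fin 2 → Matrix (n × Fin r) (n × Fin r) ℂ),
      IsDensity σ ∧ IsPOVM M ∧ p = successProb (vonNeumann U) (vonNeumann V) σ M} := by
  refine ⟨1, ?_⟩
  rintro p ⟨r, σ, M, hσ, hM, rfl⟩
  exact successProb_vonNeumann_le_one U V hσ hM

/-- The orthogonal projection onto the range of a Hermitian matrix. -/
theorem Matrix.IsHermitian.exists_support_projection {X : Matrix m m ℂ} (hX : X.IsHermitian) :
    ∃ Q : Matrix m m ℂ, Q.IsHermitian ∧ Q * Q = Q ∧ Q * X = X ∧
      ∀ Y : Matrix m m ℂ, X * Y = 0 → Q * Y = 0 := by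
  set T : Matrix m m ℂ := hX.eigenvectorUnitary.1
  have hT : Tᴴ * T = 1 := Matrix.mem_unitaryGroup_iff'.mp hX.eigenvectorUnitary.2
  set D : Matrix m m ℂ := Matrix.diagonal fun i => (hX.eigenvalues i : ℂ)
  -- Since `0⁻¹ = 0`, conjugating `N` by `T` gives the pseudo-inverse of `X`; its product with `X`
  -- is the support projection.
  set N : Matrix m m ℂ := Matrix.diagonal fun i => ((hX.eigenvalues i)⁻¹ : ℂ)
  have hspec : X = T * D * Tᴴ := hX.spectral_theorem
  have hN : N * D * N = N := by
    simp only [N, D, Matrix.diagonal_mul_diagonal]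
    congr 1
    ext i
    by_cases h : (hX.eigenvalues i : ℂ) = 0 <;> simp [h]
  have hD : N * D * D = D := by
    simp only [N, D, Matrix.diagonal_mul_diagonal]
    congr 1
    ext i
    by_cases h : (hX.eigenvalues i : ℂ) = 0 <;> simp [h]
  have hcancel (A B C : Matrix m m ℂ) : T * A * Tᴴ * (T * B * C) = T * (A * B) * C := by
    simp only [Matrix.mul_assoc]
    rw [← Matrix.mul_assoc Tᴴ, hT, Matrix.one_mul]
  have hQ : T * (N * D) * Tᴴ = T * N * Tᴴ * X := by rw [hspec, hcancel]
  refine ⟨T * (N * D) * Tᴴ, ?_, ?_, ?_, fun Y hY => ?_⟩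
  · rw [Matrix.IsHermitian]
    simp only [Matrix.conjTranspose_mul, Matrix.conjTranspose_conjTranspose, N, D,
      Matrix.diagonal_mul_diagonal, Matrix.diagonal_conjTranspose, Matrix.mul_assoc]
    congr 3
    ext i
    simp
  · have h : N * D * (N * D) = N * D := by rw [← Matrix.mul_assoc, hN]
    rw [Matrix.mul_assoc T (N * D) Tᴴ, ← Matrix.mul_assoc T (N * D) Tᴴ, hcancel, h]
  · conv_lhs => rw [hspec]
    rw [hcancel, hD, ← hspec]
  · rw [hQ, Matrix.mul_assoc, hY, Matrix.mul_zero]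

/-- Outputs with zero product have orthogonal supports, so the support projection of the first
output and its complement identify both without error. -/
theorem one_le_optimalSuccessProb_of_mul_eq_zero (U V : Matrix.unitaryGroup n ℂ) {r : ℕ}
    {σ : Matrix (n × Fin r) (n × Fin r) ℂ} (hσ : IsDensity σ)
    (h : extendByAncilla (Fin r) (vonNeumann U) σ *
      extendByAncilla (Fin r) (vonNeumann V) σ = 0) :
    1 ≤ optimalSuccessProb (vonNeumann U) (vonNeumann V) := by
  have hX := hσ.extendByAncilla_vonNeumann U
  have hY := hσ.extendByAncilla_vonNeumann V
  obtain ⟨Q, hQ, hQQ, hQX, hQY⟩ := hX.1.1.exists_support_projection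
  refine le_csSup (bddAbove_successProb_vonNeumann U V) ⟨r, σ, ![Q, 1 - Q], hσ, ⟨?_, ?_⟩, ?_⟩
  · intro i
    fin_cases i
    · have := Matrix.posSemidef_conjTranspose_mul_self Q
      rwa [hQ.eq, hQQ] at this
    · have := Matrix.posSemidef_conjTranspose_mul_self (1 - Q)
      rw [Matrix.conjTranspose_sub, hQ.eq, Matrix.conjTranspose_one] at this
      simpa [mul_sub, sub_mul, hQQ] using this
  · simp
  · simp [successProb, hQX, hQY _ h, sub_mul, hX.2, hY.2]
    norm_num

omit [DecidableEq m] in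
theorem Matrix.mul_vecMulVec_star_mul (A : Matrix m m ℂ) (ψ : m → ℂ) :
    Matrix.vecMulVec ψ (star ψ) * A * Matrix.vecMulVec ψ (star ψ) =
      (star ψ ⬝ᵥ A *ᵥ ψ) • Matrix.vecMulVec ψ (star ψ) := by
  rw [Matrix.mul_assoc, Matrix.mul_vecMulVec, Matrix.vecMulVec_mul_vecMulVec,
    Matrix.vecMulVec_smul]

/-- Perfect discrimination from an input whose reduced state `ρ` satisfies
`⟨v_i|ρ|u_i⟩ = 0` for all `i`. -/
theorem one_le_optimalSuccessProb_of_diag_eq_zero (U V : Matrix.unitaryGroup n ℂ)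
    {ρ : Matrix n n ℂ} (hρ : IsDensity ρ) (h : ∀ i, (V.1ᴴ * ρ * U.1) i i = 0) :
    1 ≤ optimalSuccessProb (vonNeumann U) (vonNeumann V) := by
  obtain ⟨B, hB⟩ := hρ.1.exists_eq_conjTranspose_mul_self
  let e := Fintype.equivFin n
  -- The conjugated entries of `B` form a purification of `ρ = B† B`, with an ancilla of dimension
  -- `card n`.
  let ψ : n × Fin (Fintype.card n) → ℂ := fun p => star (B (e.symm p.2) p.1)
  have hψ (A : Matrix n n ℂ) :
      star ψ ⬝ᵥ (A ⊗ₖ (1 : Matrix (Fin (Fintype.card n)) (Fin (Fintype.card n)) ℂ)) *ᵥ ψ =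
        (A * ρ).trace := by
    have h1 : star ψ ⬝ᵥ (A ⊗ₖ (1 : Matrix (Fin (Fintype.card n)) (Fin (Fintype.card n)) ℂ)) *ᵥ ψ
        = ∑ a, (B * A * Bᴴ) (e.symm a) (e.symm a) := by
      simp only [dotProduct, Matrix.mulVec, Fintype.sum_prod_type, Matrix.kroneckerMap_apply,
        Matrix.one_apply, ψ, Pi.star_apply, star_star, Matrix.mul_apply,
        Matrix.conjTranspose_apply, mul_ite, mul_one, mul_zero, ite_mul, zero_mul,
        Finset.sum_ite_eq, Finset.mem_univ, if_true]
      rw [Finset.sum_comm]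
      refine Finset.sum_congr rfl fun a _ => ?_
      simp only [Finset.mul_sum, Finset.sum_mul]
      rw [Finset.sum_comm]
      simp only [mul_assoc]
    rw [h1, Equiv.sum_comp e.symm fun k => (B * A * Bᴴ) k k, hB, ← Matrix.mul_assoc,
      Matrix.trace_mul_comm, ← Matrix.mul_assoc]
    rfl
  have hσ : IsDensity (Matrix.vecMulVec ψ (star ψ)) := by
    refine ⟨Matrix.posSemidef_vecMulVec_self_star ψ, ?_⟩
    have := hψ 1
    rw [Matrix.one_kronecker_one, Matrix.one_mulVec, Matrix.one_mul, hρ.2] at this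
    rw [Matrix.trace_vecMulVec, dotProduct_comm, this]
  refine one_le_optimalSuccessProb_of_mul_eq_zero U V hσ ?_
  rw [extendByAncilla_vonNeumann, extendByAncilla_vonNeumann, Finset.sum_mul_sum]
  refine Finset.sum_eq_zero fun i _ => Finset.sum_eq_zero fun j _ => ?_
  -- For `i = j` the scalar between the two copies of `ψ` is `tr (U E_ii V† ρ) = (V† ρ U)_ii`, which
  -- vanishes by `h`.
  have hmid : Matrix.vecMulVec ψ (star ψ) * ((vonNeumannKraus (Fin (Fintype.card n)) U i)ᴴ *
      vonNeumannKraus (Fin (Fintype.card n)) V j) * Matrix.vecMulVec ψ (star ψ) = 0 := by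
    rw [conjTranspose_vonNeumannKraus_mul]
    split_ifs with hij
    · rw [Matrix.mul_vecMulVec_star_mul, hψ, Matrix.mul_assoc, Matrix.mul_assoc,
        Matrix.trace_mul_comm, Matrix.mul_assoc, Matrix.trace_single_mul, h]
      simp
    · simp
  calc _ = vonNeumannKraus (Fin (Fintype.card n)) U i * (Matrix.vecMulVec ψ (star ψ) *
        ((vonNeumannKraus (Fin (Fintype.card n)) U i)ᴴ *
        vonNeumannKraus (Fin (Fintype.card n)) V j) * Matrix.vecMulVec ψ (star ψ)) *
        (vonNeumannKraus (Fin (Fintype.card n)) V j)ᴴ := by simp only [Matrix.mul_assoc]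
    _ = 0 := by rw [hmid, Matrix.mul_zero, Matrix.zero_mul]

end Discrimination

/-! ### Gaussian integrals over `ℂⁿ` -/

section Gaussian

theorem lintegral_Ioi_mul_exp_neg_sq {b c : ℝ} (hb : 0 < b) (hc : 0 ≤ c) :
    ∫⁻ r in Set.Ioi c, ENNReal.ofReal (r * Real.exp (-b * r ^ 2)) =
      ENNReal.ofReal (Real.exp (-b * c ^ 2) / (2 * b)) := by
  have hderiv : ∀ x ∈ Set.Ici c,
      HasDerivAt (fun r : ℝ => -Real.exp (-b * r ^ 2) / (2 * b)) (x * Real.exp (-b * x ^ 2)) x := by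
    intro x _
    have h := ((((hasDerivAt_id x).pow 2).const_mul (-b)).exp.neg).div_const (2 * b)
    refine h.congr_deriv ?_
    simp only [id, Pi.pow_apply]
    push_cast
    field_simp
  have hnonneg : ∀ x ∈ Set.Ioi c, 0 ≤ x * Real.exp (-b * x ^ 2) := fun x hx =>
    mul_nonneg (hc.trans (le_of_lt hx)) (Real.exp_pos _).le
  have hlim : Filter.Tendsto (fun r : ℝ => -Real.exp (-b * r ^ 2) / (2 * b)) Filter.atTop
      (nhds 0) := by
    have h1 : Filter.Tendsto (fun r : ℝ => -b * r ^ 2) Filter.atTop Filter.atBot :=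
      (Filter.tendsto_pow_atTop two_ne_zero).const_mul_atTop_of_neg (neg_lt_zero.mpr hb)
    have h2 := ((Real.tendsto_exp_atBot.comp h1).neg).div_const (2 * b)
    simpa using h2
  rw [← ofReal_integral_eq_lintegral_ofReal
      (integrableOn_Ioi_deriv_of_nonneg' hderiv hnonneg hlim)
      ((ae_restrict_iff' measurableSet_Ioi).mpr (Filter.Eventually.of_forall hnonneg)),
    integral_Ioi_of_hasDerivAt_of_nonneg' hderiv hnonneg hlim]
  congr 1
  ring

/-- Polar coordinates reduce this to a radial integral over `r > √c`, whose factor `r` makes the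
antiderivative elementary. -/
theorem lintegral_exp_neg_sq_norm_of_lt {b c : ℝ} (hb : 0 < b) (hc : 0 ≤ c) :
    ∫⁻ z in {z : ℂ | c < ‖z‖ ^ 2}, ENNReal.ofReal (Real.exp (-b * ‖z‖ ^ 2)) =
      ENNReal.ofReal (Real.pi / b * Real.exp (-b * c)) := by
  have hm : MeasurableSet {z : ℂ | c < ‖z‖ ^ 2} := measurableSet_lt (by fun_prop) (by fun_prop)
  rw [← lintegral_indicator hm, ← Complex.lintegral_comp_polarCoord_symm, polarCoord_target,
    Measure.volume_eq_prod, setLIntegral_prod]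
  swap
  · refine Measurable.aemeasurable (Measurable.mul (by fun_prop) ?_)
    refine (Measurable.indicator (by fun_prop) hm).comp ?_
    have h : Measurable fun p : ℝ × ℝ => Complex.polarCoord.symm p := by
      simp only [Complex.polarCoord_symm_apply]
      fun_prop
    exact h
  have hinner : ∀ r ∈ Set.Ioi (0 : ℝ), ∫⁻ θ in Set.Ioo (-Real.pi) Real.pi,
      ENNReal.ofReal (r, θ).1 • {z : ℂ | c < ‖z‖ ^ 2}.indicator
        (fun z => ENNReal.ofReal (Real.exp (-b * ‖z‖ ^ 2))) (Complex.polarCoord.symm (r, θ)) =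
      ENNReal.ofReal (2 * Real.pi) * (Set.Ioi (√c)).indicator
        (fun r => ENNReal.ofReal (r * Real.exp (-b * r ^ 2))) r := by
    intro r hr
    have hr' : 0 < r := hr
    have h (θ : ℝ) : ‖Complex.polarCoord.symm (r, θ)‖ = r := by
      rw [Complex.norm_polarCoord_symm, abs_of_pos hr']
    simp only [Set.indicator, Set.mem_ofPred_eq, h, Set.mem_Ioi, Real.sqrt_lt' hr', smul_eq_mul]
    rw [setLIntegral_const, Real.volume_Ioo, mul_comm]
    congr 1
    · congr 1; ring
    · split_ifs
      · rw [ENNReal.ofReal_mul hr'.le]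
      · simp
  rw [setLIntegral_congr_fun measurableSet_Ioi hinner, lintegral_const_mul _ (by measurability),
    ← lintegral_indicator measurableSet_Ioi, Set.indicator_indicator,
    Set.inter_eq_right.mpr (Set.Ioi_subset_Ioi (Real.sqrt_nonneg c)),
    lintegral_indicator measurableSet_Ioi, lintegral_Ioi_mul_exp_neg_sq hb (Real.sqrt_nonneg c),
    ← ENNReal.ofReal_mul (by positivity), Real.sq_sqrt hc]
  congr 1
  field_simp

theorem lintegral_exp_neg_sq_norm {b : ℝ} (hb : 0 < b) :
    ∫⁻ z : ℂ, ENNReal.ofReal (Real.exp (-b * ‖z‖ ^ 2)) = ENNReal.ofReal (Real.pi / b) := by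
  have h := lintegral_exp_neg_sq_norm_of_lt hb le_rfl
  rw [mul_zero, Real.exp_zero, mul_one] at h
  rw [← h]
  have : {z : ℂ | 0 < ‖z‖ ^ 2} = {0}ᶜ := by ext z; simp [sq_pos_iff]
  rw [this, setLIntegral_congr (ae_eq_univ.mpr _), setLIntegral_univ]
  simp

theorem lintegral_exp_neg_sum_sq_norm {b : ℝ} (hb : 0 < b) (n : ℕ) :
    ∫⁻ z : Fin n → ℂ, ENNReal.ofReal (Real.exp (-b * ∑ i, ‖z i‖ ^ 2)) =
      ENNReal.ofReal ((Real.pi / b) ^ n) := by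
  induction n with
  | zero => simp [Measure.volume_pi_eq_dirac (α := fun _ : Fin 0 => ℂ) Fin.elim0]
  | succ n ih =>
    rw [← (volume_preserving_piFinSuccAbove (fun _ : Fin (n + 1) => ℂ) 0).symm.lintegral_comp_emb
      (MeasurableEquiv.measurableEmbedding _), Measure.volume_eq_prod, lintegral_prod]
    swap
    · fun_prop
    simp only [MeasurableEquiv.piFinSuccAbove_symm_apply, Fin.insertNthEquiv_apply,
      Fin.sum_univ_succ, Fin.insertNth_zero', Fin.cons_zero, Fin.cons_succ, mul_add, Real.exp_add,
      ENNReal.ofReal_mul (Real.exp_pos _).le]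
    simp_rw [lintegral_const_mul' _ _ ENNReal.ofReal_ne_top]
    rw [ih, lintegral_mul_const' _ _ ENNReal.ofReal_ne_top, lintegral_exp_neg_sq_norm hb,
      ← ENNReal.ofReal_mul (by positivity), pow_succ']

/-- Integrating out `z 0` over `|z 0|² > S` gives `π e^{-S}`. This doubles the exponent for the
other `n` coordinates, each of which then contributes `π/2` instead of `π`: the source of the factor
`2^{-n}`. -/
theorem lintegral_gaussian_of_sum_lt (n : ℕ) :
    ∫⁻ z in {z : Fin (n + 1) → ℂ | ∑ i : Fin n, ‖z i.succ‖ ^ 2 < ‖z 0‖ ^ 2},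
      ENNReal.ofReal (Real.exp (-1 * ∑ i, ‖z i‖ ^ 2)) =
      ENNReal.ofReal (Real.pi * (Real.pi / 2) ^ n) := by
  have hm : MeasurableSet {z : Fin (n + 1) → ℂ | ∑ i : Fin n, ‖z i.succ‖ ^ 2 < ‖z 0‖ ^ 2} :=
    measurableSet_lt (by fun_prop) (by fun_prop)
  rw [← lintegral_indicator hm,
    ← (volume_preserving_piFinSuccAbove (fun _ : Fin (n + 1) => ℂ) 0).symm.lintegral_comp_emb
      (MeasurableEquiv.measurableEmbedding _), Measure.volume_eq_prod, lintegral_prod_symm]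
  swap
  · refine Measurable.aemeasurable ?_
    exact (Measurable.indicator (by fun_prop) hm).comp (MeasurableEquiv.measurable _)
  have hinner (y : Fin n → ℂ) : ∫⁻ x : ℂ,
      {z : Fin (n + 1) → ℂ | ∑ i : Fin n, ‖z i.succ‖ ^ 2 < ‖z 0‖ ^ 2}.indicator
        (fun z => ENNReal.ofReal (Real.exp (-1 * ∑ i, ‖z i‖ ^ 2)))
        ((MeasurableEquiv.piFinSuccAbove (fun _ : Fin (n + 1) => ℂ) 0).symm (x, y)) =
      ENNReal.ofReal Real.pi * ENNReal.ofReal (Real.exp (-2 * ∑ i, ‖y i‖ ^ 2)) := by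
    have hc : 0 ≤ ∑ i, ‖y i‖ ^ 2 := by positivity
    have hm1 : MeasurableSet {z : ℂ | ∑ i, ‖y i‖ ^ 2 < ‖z‖ ^ 2} :=
      measurableSet_lt (by fun_prop) (by fun_prop)
    have h := lintegral_exp_neg_sq_norm_of_lt one_pos hc
    rw [← lintegral_indicator hm1] at h
    have hpt (x : ℂ) : {z : Fin (n + 1) → ℂ | ∑ i : Fin n, ‖z i.succ‖ ^ 2 < ‖z 0‖ ^ 2}.indicator
        (fun z => ENNReal.ofReal (Real.exp (-1 * ∑ i, ‖z i‖ ^ 2)))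
        ((MeasurableEquiv.piFinSuccAbove (fun _ : Fin (n + 1) => ℂ) 0).symm (x, y)) =
        {z : ℂ | ∑ i, ‖y i‖ ^ 2 < ‖z‖ ^ 2}.indicator
          (fun z => ENNReal.ofReal (Real.exp (-1 * ‖z‖ ^ 2))) x *
          ENNReal.ofReal (Real.exp (-1 * ∑ i, ‖y i‖ ^ 2)) := by
      simp only [Set.indicator, Set.mem_ofPred_eq, MeasurableEquiv.piFinSuccAbove_symm_apply,
        Fin.insertNthEquiv_apply, Fin.sum_univ_succ, Fin.insertNth_zero', Fin.cons_zero,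
        Fin.cons_succ]
      split_ifs
      · rw [mul_add, Real.exp_add, ENNReal.ofReal_mul (Real.exp_pos _).le]
      · simp
    simp_rw [hpt]
    rw [lintegral_mul_const' _ _ ENNReal.ofReal_ne_top, h, ← ENNReal.ofReal_mul (by positivity),
      ← ENNReal.ofReal_mul (by positivity), mul_assoc, ← Real.exp_add, div_one]
    congr 3
    ring
  simp_rw [hinner]
  rw [lintegral_const_mul' _ _ ENNReal.ofReal_ne_top, lintegral_exp_neg_sum_sq_norm two_pos,
    ← ENNReal.ofReal_mul Real.pi_pos.le]

end Gaussian

/-! ### The two-query input state -/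

section TwoQueries

variable {n : Type*} [Fintype n] [DecidableEq n]

/-- With `u = U|i₀⟩` and `v = V|i₀⟩`, the matrix `|u⟩⟨u| + |v⟩⟨v| - z |u⟩⟨v| - z̄ |v⟩⟨u|`. -/
def columnPairGram (U V : Matrix n n ℂ) (i₀ : n) (z : ℂ) : Matrix n n ℂ :=
  U * Matrix.single i₀ i₀ 1 * Uᴴ + V * Matrix.single i₀ i₀ 1 * Vᴴ
    - z • (U * Matrix.single i₀ i₀ 1 * Vᴴ) - star z • (V * Matrix.single i₀ i₀ 1 * Uᴴ)

/-- Complete the square: the matrix is `|u - z̄v⟩⟨u - z̄v| + (1 - |z|²)|v⟩⟨v|`. -/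
theorem posSemidef_columnPairGram (U V : Matrix n n ℂ) (i₀ : n) {z : ℂ} (hz : ‖z‖ ^ 2 ≤ 1) :
    (columnPairGram U V i₀ z).PosSemidef := by
  have hE : (Matrix.single i₀ i₀ (1 : ℂ)).PosSemidef := by
    have h := Matrix.posSemidef_conjTranspose_mul_self (Matrix.single i₀ i₀ (1 : ℂ))
    simpa using h
  have hc : (0 : ℂ) ≤ ((1 - ‖z‖ ^ 2 : ℝ) : ℂ) := by
    exact_mod_cast sub_nonneg.mpr hz
  have h : columnPairGram U V i₀ z =
      (U - star z • V) * Matrix.single i₀ i₀ 1 * (U - star z • V)ᴴ +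
        ((1 - ‖z‖ ^ 2 : ℝ) : ℂ) • (V * Matrix.single i₀ i₀ 1 * Vᴴ) := by
    have hzz : ((‖z‖ ^ 2 : ℝ) : ℂ) = star z * z := by
      rw [Complex.ofReal_pow]
      exact (Complex.conj_mul' z).symm
    rw [Complex.ofReal_sub, hzz, Complex.ofReal_one, columnPairGram]
    simp only [Matrix.conjTranspose_sub, Matrix.conjTranspose_smul, star_star, sub_mul, mul_sub,
      Matrix.smul_mul, Matrix.mul_smul, smul_smul, sub_smul, one_smul, mul_comm z]
    abel
  rw [h]
  exact (hE.mul_mul_conjTranspose_same _).add ((hE.mul_mul_conjTranspose_same _).smul hc)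

theorem trace_columnPairGram (U V : Matrix.unitaryGroup n ℂ) (i₀ : n) (z : ℂ) :
    (columnPairGram U.1 V.1 i₀ z).trace =
      2 - z * (V.1ᴴ * U.1) i₀ i₀ - star z * star ((V.1ᴴ * U.1) i₀ i₀) := by
  have ht (A B : Matrix n n ℂ) :
      (A * Matrix.single i₀ i₀ 1 * Bᴴ).trace = (Bᴴ * A) i₀ i₀ := by
    rw [Matrix.trace_mul_comm, ← Matrix.mul_assoc, Matrix.trace_mul_single]
    simp
  have hU : U.1ᴴ * U.1 = 1 := Matrix.mem_unitaryGroup_iff'.mp U.2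
  have hV : V.1ᴴ * V.1 = 1 := Matrix.mem_unitaryGroup_iff'.mp V.2
  have hs : star ((V.1ᴴ * U.1) i₀ i₀) = (U.1ᴴ * V.1) i₀ i₀ := by
    rw [← Matrix.conjTranspose_apply, Matrix.conjTranspose_mul, Matrix.conjTranspose_conjTranspose]
  simp only [columnPairGram, Matrix.trace_sub, Matrix.trace_add, Matrix.trace_smul, ht, hU, hV,
    hs, Matrix.one_apply_eq, smul_eq_mul]
  ring

/-- The factor `w̄` in `z` is chosen so that, when `c + c̄ = 2`, the bracket becomes `c (1 - |w|²)`
and every diagonal entry is proportional to `c`. -/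
theorem conjTranspose_mul_columnPairGram_mul_diag (U V : Matrix.unitaryGroup n ℂ) (i₀ i : n)
    (c : ℂ) :
    (V.1ᴴ * columnPairGram U.1 V.1 i₀ (star ((V.1ᴴ * U.1) i₀ i₀) * c) * U.1) i i =
      if i = i₀ then (V.1ᴴ * U.1) i₀ i₀ * (2 - star c - c * ‖(V.1ᴴ * U.1) i₀ i₀‖ ^ 2)
      else - star ((V.1ᴴ * U.1) i₀ i₀) * c * ((V.1ᴴ * U.1) i i₀ * (V.1ᴴ * U.1) i₀ i) := by
  have hU : U.1ᴴ * U.1 = 1 := Matrix.mem_unitaryGroup_iff'.mp U.2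
  have hV : V.1ᴴ * V.1 = 1 := Matrix.mem_unitaryGroup_iff'.mp V.2
  set W : Matrix n n ℂ := V.1ᴴ * U.1 with hW
  have hassoc (A B : Matrix n n ℂ) :
      V.1ᴴ * (A * Matrix.single i₀ i₀ 1 * Bᴴ) * U.1 =
        (V.1ᴴ * A) * Matrix.single i₀ i₀ 1 * (Bᴴ * U.1) := by
    simp only [Matrix.mul_assoc]
  have hentry (A B : Matrix n n ℂ) :
      (A * Matrix.single i₀ i₀ (1 : ℂ) * B) i i = A i i₀ * B i₀ i := by
    rw [Matrix.mul_apply, Finset.sum_eq_single i₀]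
    · simp
    · intro j _ hj
      rw [Matrix.mul_single_apply_of_ne _ _ _ _ _ hj, zero_mul]
    · simp
  have hnorm : (‖W i₀ i₀‖ : ℂ) ^ 2 = star (W i₀ i₀) * W i₀ i₀ := (Complex.conj_mul' _).symm
  simp only [columnPairGram, Matrix.mul_sub, Matrix.mul_add, Matrix.sub_mul, Matrix.add_mul,
    Matrix.mul_smul, Matrix.smul_mul, hassoc, hU, hV, ← hW, Matrix.sub_apply, Matrix.add_apply,
    Matrix.smul_apply, hentry, smul_eq_mul, star_mul, star_star, hnorm]
  split_ifs with h
  · subst h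
    simp only [Matrix.one_apply_eq]
    ring
  · simp only [Matrix.one_apply_ne h, Matrix.one_apply_ne (Ne.symm h)]
    ring

theorem one_le_optimalSuccessProb_tensorSquare (U V : Matrix.unitaryGroup n ℂ) (i₀ : n)
    (h : ‖(V.1ᴴ * U.1) i₀ i₀‖ ^ 2 ≤ 1 / 2) :
    1 ≤ optimalSuccessProb (vonNeumann (tensorSquare U)) (vonNeumann (tensorSquare V)) := by
  set w : ℂ := (V.1ᴴ * U.1) i₀ i₀ with hw
  have hww : star w * w = ((‖w‖ ^ 2 : ℝ) : ℂ) := by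
    rw [Complex.ofReal_pow]
    exact Complex.conj_mul' w
  set C : ℂ → Matrix n n ℂ := fun c => columnPairGram U.1 V.1 i₀ (star w * c)
  -- Here `|z|² = 2|w|² ≤ 1`, the only place where the full strength of `h` is used.
  have hc2 (c : ℂ) (hc : ‖c‖ ^ 2 = 2) : (C c ⊗ₖ C c).PosSemidef := by
    have : (C c).PosSemidef := by
      refine posSemidef_columnPairGram _ _ _ ?_
      rw [norm_mul, norm_star, mul_pow, hc]
      linarith
    exact this.kronecker this
  have hplus : ‖(1 + Complex.I : ℂ)‖ ^ 2 = 2 := by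
    rw [← Complex.normSq_eq_norm_sq]
    simp [Complex.normSq_apply]
    norm_num
  have hminus : ‖(1 - Complex.I : ℂ)‖ ^ 2 = 2 := by
    rw [← Complex.normSq_eq_norm_sq]
    simp [Complex.normSq_apply]
    norm_num
  have hstar1 : star (1 + Complex.I) = 1 - Complex.I := by simp [sub_eq_add_neg]
  have hstar2 : star (1 - Complex.I) = 1 + Complex.I := by simp
  have htr (c : ℂ) (hc : c + star c = 2) : (C c).trace = ((2 - 2 * ‖w‖ ^ 2 : ℝ) : ℂ) := by
    rw [trace_columnPairGram, ← hw, Complex.ofReal_sub, Complex.ofReal_mul, ← hww, star_mul,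
      star_star, Complex.ofReal_ofNat]
    linear_combination (-(star w * w)) * hc
  set R : Matrix (n × n) (n × n) ℂ := C (1 + Complex.I) ⊗ₖ C (1 + Complex.I) +
    C (1 - Complex.I) ⊗ₖ C (1 - Complex.I) with hR
  have hRtr : R.trace = ((2 * (2 - 2 * ‖w‖ ^ 2) ^ 2 : ℝ) : ℂ) := by
    rw [hR, Matrix.trace_add, Matrix.trace_kronecker, Matrix.trace_kronecker,
      htr _ (by rw [hstar1]; ring), htr _ (by rw [hstar2]; ring)]
    push_cast
    ring
  have hpos : 0 < 2 * (2 - 2 * ‖w‖ ^ 2) ^ 2 := by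
    have : 0 < 2 - 2 * ‖w‖ ^ 2 := by linarith
    positivity
  have hdens : IsDensity ((((2 * (2 - 2 * ‖w‖ ^ 2) ^ 2)⁻¹ : ℝ) : ℂ) • R) := by
    constructor
    · refine ((hc2 _ hplus).add (hc2 _ hminus)).smul ?_
      exact_mod_cast (inv_pos.mpr hpos).le
    · rw [Matrix.trace_smul, hRtr, smul_eq_mul, ← Complex.ofReal_mul, inv_mul_cancel₀ hpos.ne',
        Complex.ofReal_one]
  refine one_le_optimalSuccessProb_of_diag_eq_zero _ _ hdens fun ⟨i, j⟩ => ?_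
  have hUV : (tensorSquare V).1ᴴ * R * (tensorSquare U).1 =
      (V.1ᴴ * C (1 + Complex.I) * U.1) ⊗ₖ (V.1ᴴ * C (1 + Complex.I) * U.1) +
      (V.1ᴴ * C (1 - Complex.I) * U.1) ⊗ₖ (V.1ᴴ * C (1 - Complex.I) * U.1) := by
    simp only [tensorSquare, hR, Matrix.conjTranspose_kronecker, Matrix.mul_kronecker_mul,
      Matrix.mul_add, Matrix.add_mul]
  -- Both values `c = 1 ± i` satisfy `2 - c̄ = c`, and `1 - i = -i(1 + i)`.
  have hdiag (k : n) : (V.1ᴴ * C (1 - Complex.I) * U.1) k k =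
      -Complex.I * (V.1ᴴ * C (1 + Complex.I) * U.1) k k := by
    rw [conjTranspose_mul_columnPairGram_mul_diag, conjTranspose_mul_columnPairGram_mul_diag,
      hstar1, hstar2]
    split_ifs
    · linear_combination (V.1ᴴ * U.1) i₀ i₀ * (1 - (‖(V.1ᴴ * U.1) i₀ i₀‖ : ℂ) ^ 2) *
        Complex.I_sq
    · linear_combination (-(star ((V.1ᴴ * U.1) i₀ i₀) *
        ((V.1ᴴ * U.1) k i₀ * (V.1ᴴ * U.1) i₀ k))) * Complex.I_sq
  rw [Matrix.mul_smul, Matrix.smul_mul, Matrix.smul_apply, hUV, Matrix.add_apply,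
    Matrix.kroneckerMap_apply, Matrix.kroneckerMap_apply, hdiag, hdiag, smul_eq_mul]
  linear_combination (((2 * (2 - 2 * ‖w‖ ^ 2) ^ 2)⁻¹ : ℝ) : ℂ) *
    ((V.1ᴴ * C (1 + Complex.I) * U.1) i i * (V.1ᴴ * C (1 + Complex.I) * U.1) j j) * Complex.I_sq

end TwoQueries

/-! ### The law of an entry of a Haar unitary -/

section HaarColumn

variable {n : Type*} [Fintype n] [DecidableEq n]

instance haarUnitaryIsMulLeftInvariant : (haarUnitary n).IsMulLeftInvariant := by
  unfold haarUnitary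
  infer_instance

theorem measurable_unitaryGroup_apply (i j : n) :
    Measurable fun U : Matrix.unitaryGroup n ℂ => U.1 i j :=
  (continuous_subtype_val.matrix_elem i j).measurable

theorem sum_sq_norm_unitary_mulVec {A : Matrix n n ℂ} (hA : A ∈ Matrix.unitaryGroup n ℂ)
    (z : n → ℂ) : ∑ i, ‖(A *ᵥ z) i‖ ^ 2 = ∑ i, ‖z i‖ ^ 2 := by
  have h (y : n → ℂ) : ((∑ i, ‖y i‖ ^ 2 : ℝ) : ℂ) = star y ⬝ᵥ y := by
    push_cast
    exact Finset.sum_congr rfl fun i _ => (Complex.conj_mul' _).symm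
  apply Complex.ofReal_injective
  rw [h, h, Matrix.star_mulVec, ← Matrix.dotProduct_mulVec, Matrix.mulVec_mulVec]
  have := Matrix.mem_unitaryGroup_iff'.mp hA
  rw [Matrix.star_eq_conjTranspose] at this
  rw [this, Matrix.one_mulVec]

/-- The real determinant of a complex linear map is the squared modulus of its complex determinant,
here `1`. -/
theorem measurePreserving_unitary_mulVec {A : Matrix n n ℂ}
    (hA : A ∈ Matrix.unitaryGroup n ℂ) : MeasurePreserving (fun z : n → ℂ => A *ᵥ z) := by
  have hnorm : Complex.normSq A.det = 1 := by
    have h := Unitary.mul_star_self_of_mem (Matrix.det_of_mem_unitary hA)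
    exact Complex.ofReal_injective ((Complex.mul_conj A.det).symm.trans h)
  let f : (n → ℂ) →ₗ[ℝ] (n → ℂ) := (Matrix.toLin' A).restrictScalars ℝ
  have hdet : LinearMap.det f = 1 := by
    rw [LinearMap.det_restrictScalars, LinearMap.det_toLin', Algebra.norm_complex_apply, hnorm]
  have hf : (f : (n → ℂ) → (n → ℂ)) = fun z => A *ᵥ z := rfl
  clear_value f
  have h := Measure.map_linearMap_addHaar_eq_smul_addHaar (volume : Measure (n → ℂ))
    (f := f) (by rw [hdet]; exact one_ne_zero)
  rw [hdet, inv_one, abs_one, ENNReal.ofReal_one, one_smul, hf] at h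
  exact ⟨Continuous.measurable (by fun_prop), h⟩

/-- The unitary group acts transitively on vectors of a given norm. -/
theorem exists_unitary_smul_col_eq (i₀ : n) (z : n → ℂ) :
    ∃ T : Matrix.unitaryGroup n ℂ, ∃ c : ℂ, ‖c‖ ^ 2 = ∑ i, ‖z i‖ ^ 2 ∧ ∀ k, z k = c * T.1 k i₀ := by
  by_cases hz : z = 0
  · subst hz
    exact ⟨1, 0, by simp, by simp⟩
  set x : EuclideanSpace ℂ n := WithLp.toLp 2 z
  have hx : x ≠ 0 := by simpa [x] using hz
  have hon : Orthonormal ℂ (({i₀} : Set n).domRestrict fun _ => (‖x‖⁻¹ : ℂ) • x) := by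
    constructor
    · rintro ⟨i, hi⟩
      simpa using norm_smul_inv_norm (𝕜 := ℂ) hx
    · rintro ⟨i, hi⟩ ⟨j, hj⟩ hij
      exact absurd (Subtype.ext (hi.trans hj.symm)) hij
  obtain ⟨b, hb⟩ := hon.exists_orthonormalBasis_extension_of_card_eq (by simp)
  refine ⟨⟨_, (EuclideanSpace.basisFun n ℂ).toMatrix_orthonormalBasis_mem_unitary b⟩, ‖x‖, ?_,
    fun k => ?_⟩
  · rw [Complex.norm_real, norm_norm, EuclideanSpace.norm_sq_eq]
  · have hx' : (‖x‖ : ℂ) ≠ 0 := by simpa using hx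
    simp [Module.Basis.toMatrix_apply, hb]
    rw [mul_inv_cancel_left₀ hx']

/-- Unitaries `U` with `|⟨U e_{i₀}, z⟩|² > |z|² / 2`. -/
def overlapSet (i₀ : n) (z : n → ℂ) : Set (Matrix.unitaryGroup n ℂ) :=
  {U | ∑ i, ‖z i‖ ^ 2 < 2 * ‖(U.1ᴴ *ᵥ z) i₀‖ ^ 2}

/-- Write `z = c T e_{i₀}` with `T` unitary; left invariance replaces `U` by `T U`, and the scale
`|c|²` cancels from the inequality. -/
theorem haarUnitary_overlapSet_eq (i₀ : n) {z : n → ℂ} (hz : z ≠ 0) :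
    haarUnitary n (overlapSet i₀ z) = haarUnitary n {U | 1 < 2 * ‖U.1 i₀ i₀‖ ^ 2} := by
  obtain ⟨T, c, hc, hT⟩ := exists_unitary_smul_col_eq i₀ z
  have hpos : 0 < ‖c‖ ^ 2 := by
    rw [sq_pos_iff, norm_ne_zero_iff]
    rintro rfl
    exact hz (funext fun k => by simp [hT])
  rw [← measure_preimage_mul (haarUnitary n) T (overlapSet i₀ z)]
  congr 1
  ext U
  have hzT : z = c • (T.1 *ᵥ Pi.single i₀ 1) := by
    ext k
    simp [hT]
  have hTT : T.1ᴴ * T.1 = 1 := Matrix.mem_unitaryGroup_iff'.mp T.2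
  have hval : ((T * U).1ᴴ *ᵥ z) i₀ = c * star (U.1 i₀ i₀) := by
    rw [hzT, Submonoid.coe_mul, Matrix.conjTranspose_mul, Matrix.mulVec_smul,
      Matrix.mulVec_mulVec, Matrix.mul_assoc, hTT, Matrix.mul_one]
    simp
  simp only [overlapSet, Set.mem_preimage, Set.mem_ofPred_eq, hval, ← hc, norm_mul, norm_star,
    mul_pow]
  rw [mul_left_comm, lt_mul_iff_one_lt_right hpos]

theorem measurable_conjTranspose_mulVec (i₀ : n) :
    Measurable fun p : Matrix.unitaryGroup n ℂ × (n → ℂ) => (p.1.1ᴴ *ᵥ p.2) i₀ := by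
  simp only [Matrix.mulVec, dotProduct, Matrix.conjTranspose_apply]
  refine Finset.measurable_sum _ fun k _ => Measurable.mul ?_ (by fun_prop)
  exact Complex.continuous_conj.measurable.comp ((measurable_unitaryGroup_apply k i₀).comp measurable_fst)

theorem measurableSet_overlapSet_prod (i₀ : n) :
    MeasurableSet {p : Matrix.unitaryGroup n ℂ × (n → ℂ) | p.1 ∈ overlapSet i₀ p.2} :=
  measurableSet_lt (by fun_prop) (((measurable_conjTranspose_mulVec i₀).norm.pow_const 2).const_mul 2)

/-- Integrate the Gaussian weight over the pairs `(U, z)` with `U ∈ overlapSet 0 z` in both orders.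
Fixing `U` and rotating by `U†` gives `π(π/2)^N`; fixing `z ≠ 0` gives `q` times the weight, hence
`q π^{N+1}` in total. -/
theorem haarUnitary_apply_zero_zero (N : ℕ) :
    haarUnitary (Fin (N + 1)) {U | 1 < 2 * ‖U.1 0 0‖ ^ 2} = 1 / 2 ^ N := by
  set q := haarUnitary (Fin (N + 1)) {U | 1 < 2 * ‖U.1 0 0‖ ^ 2}
  let g : (Fin (N + 1) → ℂ) → ℝ≥0∞ := fun z => ENNReal.ofReal (Real.exp (-1 * ∑ i, ‖z i‖ ^ 2))
  have hg : Measurable g := by fun_prop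
  let F : Matrix.unitaryGroup (Fin (N + 1)) ℂ → (Fin (N + 1) → ℂ) → ℝ≥0∞ := fun U z =>
    {p : Matrix.unitaryGroup (Fin (N + 1)) ℂ × (Fin (N + 1) → ℂ) |
      p.1 ∈ overlapSet 0 p.2}.indicator (fun p => g p.2) (U, z)
  have hF : Measurable (Function.uncurry F) :=
    (hg.comp measurable_snd).indicator (measurableSet_overlapSet_prod 0)
  have hswap := lintegral_lintegral_swap (μ := haarUnitary (Fin (N + 1)))
    (ν := (volume : Measure (Fin (N + 1) → ℂ))) hF.aemeasurable
  have hleft (U : Matrix.unitaryGroup (Fin (N + 1)) ℂ) :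
      ∫⁻ z, F U z = ENNReal.ofReal (Real.pi * (Real.pi / 2) ^ N) := by
    have hU : U.1ᴴ ∈ Matrix.unitaryGroup (Fin (N + 1)) ℂ := (star U).2
    have hm : MeasurableSet {z : Fin (N + 1) → ℂ | ∑ i : Fin N, ‖z i.succ‖ ^ 2 < ‖z 0‖ ^ 2} :=
      measurableSet_lt (by fun_prop) (by fun_prop)
    rw [← lintegral_gaussian_of_sum_lt N, ← lintegral_indicator hm,
      ← (measurePreserving_unitary_mulVec hU).lintegral_comp (Measurable.indicator (by fun_prop) hm)]
    refine lintegral_congr fun z => ?_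
    have hs := sum_sq_norm_unitary_mulVec hU z
    simp only [F, g, Set.indicator, Set.mem_ofPred_eq, overlapSet, hs]
    congr 1
    rw [← hs, Fin.sum_univ_succ]
    exact propext ⟨fun h => by linarith, fun h => by linarith⟩
  have hright : ∀ᵐ z : Fin (N + 1) → ℂ, ∫⁻ U, F U z ∂(haarUnitary (Fin (N + 1))) = q * g z := by
    -- At `z = 0` the overlap set is empty, so this null set must be excluded.
    have h0 : ∀ᵐ z : Fin (N + 1) → ℂ, z ≠ 0 := by
      simp [ae_iff]
    filter_upwards [h0] with z hz
    have hm : MeasurableSet (overlapSet (0 : Fin (N + 1)) z) :=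
      measurable_prodMk_right (measurableSet_overlapSet_prod 0)
    have hFz (U : Matrix.unitaryGroup (Fin (N + 1)) ℂ) :
        F U z = (overlapSet 0 z).indicator (fun _ => g z) U := rfl
    simp_rw [hFz]
    rw [lintegral_indicator_const hm, haarUnitary_overlapSet_eq 0 hz, mul_comm]
  simp_rw [hleft] at hswap
  rw [lintegral_const, measure_univ, mul_one, lintegral_congr_ae hright,
    lintegral_const_mul _ hg, lintegral_exp_neg_sum_sq_norm one_pos, div_one] at hswap
  have hne : ENNReal.ofReal (Real.pi ^ (N + 1)) ≠ 0 := by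
    rw [Ne, ENNReal.ofReal_eq_zero, not_le]
    positivity
  have hpow : (1 / 2 ^ N : ℝ≥0∞) = ENNReal.ofReal ((1 / 2) ^ N) := by
    rw [ENNReal.ofReal_pow (by norm_num), ENNReal.ofReal_div_of_pos two_pos, ENNReal.ofReal_one,
      ENNReal.ofReal_ofNat, one_div, one_div, ENNReal.inv_pow]
  refine (ENNReal.mul_left_inj hne ENNReal.ofReal_ne_top).mp (hswap.symm.trans ?_)
  rw [hpow, ← ENNReal.ofReal_mul (by positivity)]
  congr 1
  rw [div_pow, div_pow, one_pow]
  ring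

end HaarColumn

/-! ### The probability bound -/

theorem mainTheorem5 (d : ℕ) (hd : 1 ≤ d)
    {Ω : Type*} [MeasurableSpace Ω] (P : Measure Ω) [IsProbabilityMeasure P]
    (U V : Ω → Matrix.unitaryGroup (Fin d) ℂ)
    (hU : HasLaw U (haarUnitary (Fin d)) P) (hV : HasLaw V (haarUnitary (Fin d)) P)
    (hUV : IndepFun U V P) :
    P {ω | optimalSuccessProb (vonNeumann (tensorSquare (U ω)))
        (vonNeumann (tensorSquare (V ω))) < 1} ≤ 1 / 2 ^ (d - 1) := by
  obtain ⟨N, rfl⟩ : ∃ N, d = N + 1 := ⟨d - 1, by omega⟩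
  let G := Matrix.unitaryGroup (Fin (N + 1)) ℂ
  have hcol : Measurable fun W : G => fun k => W.1 k 0 :=
    measurable_pi_lambda _ fun k => measurable_unitaryGroup_apply k 0
  let S : Set (G × G) := {p | p.1 ∈ overlapSet 0 fun k => p.2.1 k 0}
  have hS : MeasurableSet S :=
    (measurable_fst.prodMk (hcol.comp measurable_snd)) (measurableSet_overlapSet_prod 0)
  have hnormcol (W : G) : ∑ k, ‖W.1 k 0‖ ^ 2 = 1 := by
    have h := sum_sq_norm_unitary_mulVec W.2 (Pi.single 0 1)
    simpa [Pi.single_apply, Fin.sum_univ_succ] using h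
  -- Inclusion in a measurable event suffices, so measurability of the optimal probability in `ω` is
  -- never required.
  have hsub : {ω | optimalSuccessProb (vonNeumann (tensorSquare (U ω)))
      (vonNeumann (tensorSquare (V ω))) < 1} ⊆ (fun ω => (U ω, V ω)) ⁻¹' S := by
    intro ω hω
    by_contra hnot
    refine absurd hω (not_lt.mpr (one_le_optimalSuccessProb_tensorSquare (U ω) (V ω) 0 ?_))
    have h1 : ¬ (∑ k, ‖(V ω).1 k 0‖ ^ 2 <
      2 * ‖((U ω).1ᴴ *ᵥ fun k => (V ω).1 k 0) 0‖ ^ 2) := hnot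
    have h2 : ((U ω).1ᴴ *ᵥ fun k => (V ω).1 k 0) 0 =
        star (((V ω).1ᴴ * (U ω).1) 0 0) := by
      rw [← Matrix.conjTranspose_apply, Matrix.conjTranspose_mul,
        Matrix.conjTranspose_conjTranspose]
      rfl
    rw [hnormcol, h2, norm_star] at h1
    linarith
  calc P _ ≤ P ((fun ω => (U ω, V ω)) ⁻¹' S) := measure_mono hsub
    _ = (haarUnitary (Fin (N + 1))).prod (haarUnitary (Fin (N + 1))) S := by
      rw [← Measure.map_apply_of_aemeasurable (hU.aemeasurable.prodMk hV.aemeasurable) hS,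
        (indepFun_iff_map_prod_eq_prod_map_map hU.aemeasurable hV.aemeasurable).mp hUV,
        hU.map_eq, hV.map_eq]
    _ = ∫⁻ _, 1 / 2 ^ N ∂(haarUnitary (Fin (N + 1))) := by
      -- With `V` fixed, its column is a nonzero vector, and the conditional probability over `U`
      -- does not depend on it.
      rw [Measure.prod_apply_symm hS]
      refine lintegral_congr fun W => ?_
      have hne : (fun k => W.1 k 0) ≠ 0 := by
        intro h
        have h1 := hnormcol W
        have h2 (k) : W.1 k 0 = 0 := congrFun h k
        simp [h2] at h1
      exact (haarUnitary_overlapSet_eq 0 hne).trans (haarUnitary_apply_zero_zero N)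
    _ = 1 / 2 ^ (N + 1 - 1) := by simp
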